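/- Let $\mathbf P$ be a countable set of propositional letters and let $p\in\mathbf P$. Models are Kripke models $M=(W,R,V)$ with $W\neq\emptyset$, $R\subseteq W\times W$ and $V:\mathbf P\to 2^W$. Formulas of modal iterative substitution logic ($\mathsf{MISL}$) are given by $\varphi::=q\mid\neg\varphi\mid\varphi\land\varphi\mid\Diamond\varphi\mid\langle q:=\psi\rangle\varphi\mid\langle (q:=\psi)^*\rangle\varphi$ with $q\in\mathbf P$, where $\bot,\lor,\Box$ are the usual abbreviations. Letters, Boolean connectives and $\Diamond$ are interpreted as in modal logic. $M,s\vDash\langle q:=\psi\rangle\varphi$ holds iff $M|_{q:=\psi},s\vDash\varphi$, where $M|_{q:=\psi}$ is $M$ with the value of $q$ replaced by the truth set of $\psi$ in $M$. $M,s\vDash\langle (q:=\psi)^*\rangle\varphi$ holds iff for some $n\in\mathbb N$ the formula $\varphi$ holds at $s$ in the model obtained from $M$ by $n$ successive transformations $N\mapsto N|_{q:=\psi}$. We write $\langle q:=\psi;\,(q:=\chi)^*\rangle\varphi$ for $\langle q:=\psi\rangle\langle (q:=\chi)^*\rangle\varphi$. Formulas of the modal $\mu$-calculus $\mu\mathsf{ML}$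 are given by $\varphi::=q\mid\neg\varphi\mid\varphi\land\varphi\mid\Diamond\varphi\mid\mu q.\varphi\mid\nu q.\varphi$, where $\mu q.\varphi$ and $\nu q.\varphi$ are allowed only if every free occurrence of $q$ in $\varphi$ is under an even number of negations; $\mu q.\varphi$ and $\nu q.\varphi$ denote the least and the greatest fixed point of the map $F_\varphi$ sending $S\subseteq W$ to the truth set of $\varphi$ with $q$ interpreted as $S$. Theorem. There is no formula $\psi$ of $\mu\mathsf{ML}$ such that, for every model $M$ and every state $s$ of $M$, $$M,s\vDash\langle p:=\Box\bot;\,(p:=p\lor\Box\Diamond p)^*\rangle\bigl(\Diamond p\land\Diamond(\neg p\land\Box\Diamond p)\bigr)\quad\Longleftrightarrow\quad M,s\vDash\psi .$$ The same holds when only finite sequences of approximation are allowed in $\mu\mathsf{ML}$, that is, when $\mu q.\varphi$ is interpreted as $\bigcup_{n\in\mathbb N}F_\varphi^n(\emptyset)$ and $\nu q.\varphi$ as $\bigcap_{n\in\mathbb N}F_\varphi^n(W)$. -/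

import Mathlib

universe u v

/-- Kripke models over a set `P` of propositional letters. -/
structure KripkeModel (P : Type v) where
  /-- the states -/
  W : Type u
  /-- there is at least one state -/
  nonempty : Nonempty W
  /-- the accessibility relation -/
  R : W → W → Prop
  /-- the valuation -/
  V : P → Set W

/-! ## Modal iterative substitution logic -/

/-- Formulas of modal iterative substitution logic. -/
inductive MISLFormula (P : Type v) where
  | var (p : P) : MISLFormula P
  | neg (φ : MISLFormula P) : MISLFormula P
  | and (φ ψ : MISLFormula P) : MISLFormula P
  | dia (φ : MISLFormula P) : MISLFormula P
  /-- `⟨p := ψ⟩ φ` -/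
  | sub (p : P) (ψ φ : MISLFormula P) : MISLFormula P
  /-- `⟨(p := ψ)*⟩ φ` -/
  | iter (p : P) (ψ φ : MISLFormula P) : MISLFormula P

namespace MISLFormula

/-- `φ ∨ ψ` -/
def or {P : Type v} (φ ψ : MISLFormula P) : MISLFormula P := neg (and (neg φ) (neg ψ))

/-- `□ φ` -/
def box {P : Type v} (φ : MISLFormula P) : MISLFormula P := neg (dia (neg φ))

/-- `⊥`, written as `p ∧ ¬ p`. -/
def bot {P : Type v} (p : P) : MISLFormula P := and (var p) (neg (var p))

/-- The valuation after `n` substitutions of the truth set of a formula for the letter `p`, where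
`t U` is the truth set of that formula under the valuation `U`. -/
def iterVal {P : Type v} [DecidableEq P] {W : Type u} (p : P) (t : (P → Set W) → Set W)
    (V : P → Set W) : ℕ → P → Set W
  | 0 => V
  | n + 1 => Function.update (iterVal p t V n) p (t (iterVal p t V n))

/-- The truth set of a formula in the model `(W, R, V)`. -/
def truth {P : Type v} [DecidableEq P] {W : Type u} (R : W → W → Prop) :
    MISLFormula P → (P → Set W) → Set W
  | var p, V => V p
  | neg φ, V => (truth R φ V)ᶜ
  | and φ ψ, V => truth R φ V ∩ truth R ψ V
  | dia φ, V => {s | ∃ t, R s t ∧ t ∈ truth R φ V}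
  | sub p ψ φ, V => truth R φ (Function.update V p (truth R ψ V))
  | iter p ψ φ, V => {s | ∃ n : ℕ, s ∈ truth R φ (iterVal p (truth R ψ) V n)}

/-- `M, s ⊨ φ` in modal iterative substitution logic. -/
def Sat {P : Type v} [DecidableEq P] (M : KripkeModel.{u} P) (s : M.W) (φ : MISLFormula P) :
    Prop :=
  s ∈ truth M.R φ M.V

/-- `⟨p := □⊥; (p := p ∨ □◇p)*⟩ (◇p ∧ ◇(¬p ∧ □◇p))` -/
def rankFormula {P : Type v} (p : P) : MISLFormula P :=
  sub p (box (bot p))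
    (iter p (or (var p) (box (dia (var p))))
      (and (dia (var p)) (dia (and (neg (var p)) (box (dia (var p)))))))

end MISLFormula

/-! ## The modal μ-calculus -/

/-- Raw formulas of the modal μ-calculus; the formulas proper are the well-formed ones, see
`MuFormula.WellFormed`. -/
inductive MuFormula (P : Type v) where
  | var (p : P) : MuFormula P
  | neg (φ : MuFormula P) : MuFormula P
  | and (φ ψ : MuFormula P) : MuFormula P
  | dia (φ : MuFormula P) : MuFormula P
  /-- the least fixed point `μ p. φ` -/
  | mu (p : P) (φ : MuFormula P) : MuFormula P
  /-- the greatest fixed point `ν p. φ` -/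
  | nu (p : P) (φ : MuFormula P) : MuFormula P

namespace MuFormula

/-- For `b = true`: every free occurrence of `q` in the formula is under an even number of
negations. For `b = false`: every one is under an odd number of negations. -/
def HasPolarity {P : Type v} (q : P) : MuFormula P → Bool → Prop
  | var p, b => p = q → b = true
  | neg φ, b => HasPolarity q φ (!b)
  | and φ ψ, b => HasPolarity q φ b ∧ HasPolarity q ψ b
  | dia φ, b => HasPolarity q φ b
  | mu p φ, b => p = q ∨ HasPolarity q φ b
  | nu p φ, b => p = q ∨ HasPolarity q φ b

/-- In every subformula `μ p. φ` or `ν p. φ`, all free occurrences of `p` in `φ` are positive. -/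
def WellFormed {P : Type v} : MuFormula P → Prop
  | var _ => True
  | neg φ => WellFormed φ
  | and φ ψ => WellFormed φ ∧ WellFormed ψ
  | dia φ => WellFormed φ
  | mu p φ => HasPolarity p φ true ∧ WellFormed φ
  | nu p φ => HasPolarity p φ true ∧ WellFormed φ

/-- The truth set of a μ-calculus formula in the model `(W, R, V)`: `μ p. φ` is the least pre-fixed
point and `ν p. φ` the greatest post-fixed point of `S ↦ ⟦φ⟧` with `p` interpreted as `S`. -/
def truth {P : Type v} [DecidableEq P] {W : Type u} (R : W → W → Prop) :
    MuFormula P → (P → Set W) → Set W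
  | var p, V => V p
  | neg φ, V => (truth R φ V)ᶜ
  | and φ ψ, V => truth R φ V ∩ truth R ψ V
  | dia φ, V => {s | ∃ t, R s t ∧ t ∈ truth R φ V}
  | mu p φ, V => ⋂₀ {S | truth R φ (Function.update V p S) ⊆ S}
  | nu p φ, V => ⋃₀ {S | S ⊆ truth R φ (Function.update V p S)}

/-- The truth set of a μ-calculus formula under the convention that only finite sequences of
approximation are allowed: `μ p. φ` is the union of the finite approximations from below, and
`ν p. φ` is the intersection of the finite approximations from above. -/
def finTruth {P : Type v} [DecidableEq P] {W : Type u} (R : W → W → Prop) :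
    MuFormula P → (P → Set W) → Set W
  | var p, V => V p
  | neg φ, V => (finTruth R φ V)ᶜ
  | and φ ψ, V => finTruth R φ V ∩ finTruth R ψ V
  | dia φ, V => {s | ∃ t, R s t ∧ t ∈ finTruth R φ V}
  | mu p φ, V => ⋃ n : ℕ, (fun S => finTruth R φ (Function.update V p S))^[n] ∅
  | nu p φ, V => ⋂ n : ℕ, (fun S => finTruth R φ (Function.update V p S))^[n] Set.univ

/-- `M, s ⊨ φ` in the modal μ-calculus. -/
def Sat {P : Type v} [DecidableEq P] (M : KripkeModel.{u} P) (s : M.W) (φ : MuFormula P) : Prop :=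
  s ∈ truth M.R φ M.V

/-- `M, s ⊨ φ` in the modal μ-calculus with only finite sequences of approximation. -/
def FinSat {P : Type v} [DecidableEq P] (M : KripkeModel.{u} P) (s : M.W) (φ : MuFormula P) :
    Prop :=
  s ∈ finTruth M.R φ M.V

end MuFormula

/-! The iterated substitution computes, stage by stage, the positions lost within finitely many
rounds of a game, and the formula says that some stage `n` contains one successor while another
successor enters exactly at stage `n + 1`. It thus compares the ranks of two successors, and ranks
are unbounded.

A μ-formula cannot do this. Add to a frame a root that no state sees. Old states ignore the root,
and at the root a fixed point amounts to one unfolding. So truth at the root depends only on which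
sets of a finite family the successor set `C` meets, and the size of that family depends only on the
formula (`exists_finite_none_mem_truth_iff`). On a long enough chain, two even positions `x < y` lie
in the same members of the family, so the formula cannot tell `C = {x, y}` from `C = {x}`; the rank
formula holds for the first and fails for the second. These models are finite, where finite
approximations reach the fixed points (`finTruth_eq_truth`), which settles the second semantics. -/

open Function

namespace MuFormula

variable {P : Type v} [DecidableEq P] {W : Type u}

/-! ### Monotonicity and finite approximations -/

/-- Both polarities go through one induction because negation exchanges them. -/
theorem truth_update_mono (R : W → W → Prop) (q : P) (φ : MuFormula P) :
    ∀ (b : Bool), HasPolarity q φ b → ∀ (V : P → Set W) (S T : Set W), S ⊆ T →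
      (b = true → truth R φ (update V q S) ⊆ truth R φ (update V q T)) ∧
      (b = false → truth R φ (update V q T) ⊆ truth R φ (update V q S)) := by
  induction φ with
  | var p =>
    intro b h V S T hST
    by_cases hp : p = q
    · subst hp
      have hb := h rfl
      subst hb
      simpa [truth] using hST
    · simp [truth, update_of_ne hp]
  | neg φ ih =>
    intro b h V S T hST
    have := ih (!b) h V S T hST
    constructor
    · rintro rfl
      exact Set.compl_subset_compl.2 (this.2 rfl)
    · rintro rfl
      exact Set.compl_subset_compl.2 (this.1 rfl)
  | and φ ψ ih₁ ih₂ =>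
    intro b h V S T hST
    have h₁ := ih₁ b h.1 V S T hST
    have h₂ := ih₂ b h.2 V S T hST
    exact ⟨fun hb => Set.inter_subset_inter (h₁.1 hb) (h₂.1 hb),
      fun hb => Set.inter_subset_inter (h₁.2 hb) (h₂.2 hb)⟩
  | dia φ ih =>
    intro b h V S T hST
    have := ih b h V S T hST
    exact ⟨fun hb s ⟨t, hR, ht⟩ => ⟨t, hR, this.1 hb ht⟩,
      fun hb s ⟨t, hR, ht⟩ => ⟨t, hR, this.2 hb ht⟩⟩
  | mu p φ ih =>
    intro b h V S T hST
    by_cases hp : p = q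
    · subst hp
      simp [truth]
    · have key := fun U : Set W => ih b (h.resolve_left hp) (update V p U) S T hST
      simp only [truth, fun U A : Set W => update_comm (Ne.symm hp) U A V]
      exact ⟨fun hb => Set.sInter_subset_sInter fun U hU => ((key U).1 hb).trans hU,
        fun hb => Set.sInter_subset_sInter fun U hU => ((key U).2 hb).trans hU⟩
  | nu p φ ih =>
    intro b h V S T hST
    by_cases hp : p = q
    · subst hp
      simp [truth]
    · have key := fun U : Set W => ih b (h.resolve_left hp) (update V p U) S T hST
      simp only [truth, fun U A : Set W => update_comm (Ne.symm hp) U A V]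
      exact ⟨fun hb => Set.sUnion_subset_sUnion fun U hU => Set.Subset.trans hU ((key U).1 hb),
        fun hb => Set.sUnion_subset_sUnion fun U hU => Set.Subset.trans hU ((key U).2 hb)⟩

theorem monotone_truth_update (R : W → W → Prop) {q : P} {φ : MuFormula P}
    (h : HasPolarity q φ true) (V : P → Set W) :
    Monotone fun S => truth R φ (update V q S) :=
  fun S T hST => (truth_update_mono R q φ true h V S T hST).1 rfl

/-- The increasing chain of approximations stabilizes in a finite powerset, and its limit is a fixed
point. -/
theorem iUnion_iterate_eq_sInter [Finite W] {F : Set W → Set W} (hF : Monotone F) :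
    ⋃ n : ℕ, F^[n] ∅ = ⋂₀ {S | F S ⊆ S} := by
  apply Set.Subset.antisymm
  · refine Set.iUnion_subset fun n => Set.subset_sInter fun S hS => ?_
    induction n with
    | zero => exact Set.empty_subset S
    | succ n ih =>
      rw [iterate_succ_apply']
      exact (hF ih).trans hS
  · refine Set.sInter_subset_of_mem ?_
    have hmono : Monotone fun n : ℕ => F^[n] ∅ :=
      hF.monotone_iterate_of_le_map (Set.empty_subset _)
    obtain ⟨n, hn⟩ := WellFoundedGT.monotone_chain_condition ⟨_, hmono⟩
    have hU : ⋃ n : ℕ, F^[n] ∅ = F^[n] ∅ := by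
      refine Set.Subset.antisymm (Set.iUnion_subset fun m => ?_) (Set.subset_iUnion (fun n : ℕ => F^[n] ∅) n)
      rcases le_total n m with h | h
      · exact (hn m h).ge
      · exact hmono h
    rw [Set.mem_ofPred_eq, hU, ← iterate_succ_apply' F]
    exact (hn (n + 1) n.le_succ).ge

theorem iInter_iterate_eq_sUnion [Finite W] {F : Set W → Set W} (hF : Monotone F) :
    ⋂ n : ℕ, F^[n] Set.univ = ⋃₀ {S | S ⊆ F S} := by
  apply Set.Subset.antisymm
  · refine Set.subset_sUnion_of_mem ?_
    have hanti : Antitone fun n : ℕ => F^[n] Set.univ :=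
      hF.antitone_iterate_of_map_le (Set.subset_univ _)
    obtain ⟨n, hn⟩ := WellFoundedGT.monotone_chain_condition
      (α := (Set W)ᵒᵈ) ⟨_, hanti.dual_right⟩
    have hU : ⋂ n : ℕ, F^[n] Set.univ = F^[n] Set.univ := by
      refine Set.Subset.antisymm (Set.iInter_subset (fun n : ℕ => F^[n] Set.univ) n) (Set.subset_iInter fun m => ?_)
      rcases le_total n m with h | h
      · exact (congrArg OrderDual.ofDual (hn m h)).le
      · exact hanti h
    rw [Set.mem_ofPred_eq, hU, ← iterate_succ_apply' F]
    exact (congrArg OrderDual.ofDual (hn (n + 1) n.le_succ)).le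
  · refine Set.subset_iInter fun n => Set.sUnion_subset fun S hS => ?_
    induction n with
    | zero => exact Set.subset_univ S
    | succ n ih =>
      rw [iterate_succ_apply']
      exact Set.Subset.trans hS (hF ih)

/-- On finite models the finite approximations reach the fixed points. -/
theorem finTruth_eq_truth [Finite W] (R : W → W → Prop) (φ : MuFormula P) (h : φ.WellFormed) :
    ∀ V : P → Set W, finTruth R φ V = truth R φ V := by
  induction φ with
  | var p => exact fun V => rfl
  | neg φ ih => exact fun V => by rw [finTruth, truth, ih h]
  | and φ ψ ih₁ ih₂ => exact fun V => by rw [finTruth, truth, ih₁ h.1, ih₂ h.2]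
  | dia φ ih => exact fun V => by rw [finTruth, truth, ih h]
  | mu p φ ih =>
    intro V
    simp only [finTruth, truth, ih h.2]
    exact iUnion_iterate_eq_sInter (monotone_truth_update R h.1 V)
  | nu p φ ih =>
    intro V
    simp only [finTruth, truth, ih h.2]
    exact iInter_iterate_eq_sUnion (monotone_truth_update R h.1 V)

/-! ### Adding a root to a frame -/

/-- The frame `(W, R)` with a new root `none` whose successors are the elements of `C`. -/
def rooted (R : W → W → Prop) (C : Set W) : Option W → Option W → Prop
  | none, some y => y ∈ C
  | some x, some y => R x y
  | _, none => False

theorem preimage_update (V : P → Set (Option W)) (p : P) (S : Set (Option W)) :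
    (fun q => some ⁻¹' update V p S q) = update (fun q => some ⁻¹' V q) p (some ⁻¹' S) := by
  funext q
  by_cases hq : q = p
  · subst hq
    simp
  · simp [update_of_ne hq]

theorem preimage_some_image (S : Set W) : (some ⁻¹' (some '' S) : Set W) = S :=
  Set.preimage_image_eq S (Option.some_injective W)

theorem preimage_some_insert_none (S : Set W) :
    (some ⁻¹' insert none (some '' S) : Set W) = S := by
  ext x
  simp

/-- The old states form a generated subframe: none of them sees the root. -/
theorem some_mem_truth_rooted (R : W → W → Prop) (C : Set W) (φ : MuFormula P) :
    ∀ (V : P → Set (Option W)) (x : W),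
      some x ∈ truth (rooted R C) φ V ↔ x ∈ truth R φ fun q => some ⁻¹' V q := by
  induction φ with
  | var p => exact fun V x => Iff.rfl
  | neg φ ih => exact fun V x => not_congr (ih V x)
  | and φ ψ ih₁ ih₂ => exact fun V x => and_congr (ih₁ V x) (ih₂ V x)
  | dia φ ih =>
    intro V x
    constructor
    · rintro ⟨_ | y, hR, hy⟩
      · exact hR.elim
      · exact ⟨y, hR, (ih V y).1 hy⟩
    · rintro ⟨y, hR, hy⟩
      exact ⟨some y, hR, (ih V y).2 hy⟩
  | mu p φ ih =>
    intro V x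
    constructor
    · intro h S hS
      -- With the root included, the pre-fixed point condition is trivial there.
      have := h (insert none (some '' S)) fun y hy => by
        rcases y with _ | y
        · exact Set.mem_insert _ _
        · rw [ih, preimage_update, preimage_some_insert_none] at hy
          exact Or.inr ⟨y, hS hy, rfl⟩
      simpa using this
    · intro h S hS
      refine h (some ⁻¹' S) fun y hy => hS ?_
      rwa [ih, preimage_update]
  | nu p φ ih =>
    intro V x
    constructor
    · rintro ⟨S, hS, hx⟩
      refine ⟨some ⁻¹' S, fun y hy => ?_, hx⟩
      rw [← preimage_update, ← ih]
      exact hS hy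
    · rintro ⟨S, hS, hx⟩
      -- With the root left out, the post-fixed point condition is trivial there.
      refine ⟨some '' S, ?_, x, hx, rfl⟩
      rintro _ ⟨y, hy, rfl⟩
      rw [ih, preimage_update, preimage_some_image]
      exact hS hy

/-! ### Fixed points at the root -/

theorem truth_update_mu_subset (R : W → W → Prop) {p : P} {φ : MuFormula P}
    (h : HasPolarity p φ true) (V : P → Set W) :
    truth R φ (update V p (truth R (mu p φ) V)) ⊆ truth R (mu p φ) V :=
  fun _ hx S hS =>
    have hsub : truth R (mu p φ) V ⊆ S := Set.sInter_subset_of_mem hS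
    hS (monotone_truth_update R h V hsub hx)

theorem subset_truth_update_nu (R : W → W → Prop) {p : P} {φ : MuFormula P}
    (h : HasPolarity p φ true) (V : P → Set W) :
    truth R (nu p φ) V ⊆ truth R φ (update V p (truth R (nu p φ) V)) :=
  fun _ ⟨S, hS, hx⟩ =>
    have hsub : S ⊆ truth R (nu p φ) V := Set.subset_sUnion_of_mem hS
    monotone_truth_update R h V hsub (hS hx)

/-- At the root a least fixed point is reached by one unfolding. -/
theorem none_mem_truth_mu (R : W → W → Prop) (C : Set W) {p : P} {φ : MuFormula P}
    (h : HasPolarity p φ true) (V : P → Set (Option W)) :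
    none ∈ truth (rooted R C) (mu p φ) V ↔
      none ∈ truth (rooted R C) φ
        (update V p (some '' truth R (mu p φ) fun q => some ⁻¹' V q)) := by
  constructor
  · intro hn
    by_contra hc
    -- If the unfolding fails at the root, the old fixed point is already a pre-fixed point of the
    -- rooted frame, and it omits the root.
    have := hn (some '' truth R (mu p φ) fun q => some ⁻¹' V q) fun y hy => by
      rcases y with _ | y
      · exact (hc hy).elim
      · rw [some_mem_truth_rooted, preimage_update, preimage_some_image] at hy
        exact ⟨y, truth_update_mu_subset R h _ hy, rfl⟩
    simp at this
  · intro hn S hS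
    refine hS (monotone_truth_update _ h V ?_ hn)
    rintro _ ⟨y, hy, rfl⟩
    exact (some_mem_truth_rooted R C (mu p φ) V y).2 hy S hS

/-- At the root a greatest fixed point is reached by one unfolding. -/
theorem none_mem_truth_nu (R : W → W → Prop) (C : Set W) {p : P} {φ : MuFormula P}
    (h : HasPolarity p φ true) (V : P → Set (Option W)) :
    none ∈ truth (rooted R C) (nu p φ) V ↔
      none ∈ truth (rooted R C) φ
        (update V p (insert none (some '' truth R (nu p φ) fun q => some ⁻¹' V q))) := by
  constructor
  · rintro ⟨S, hS, hn⟩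
    refine monotone_truth_update _ h V ?_ (hS hn)
    rintro (_ | y) hy
    · exact Set.mem_insert _ _
    · exact Or.inr ⟨y, (some_mem_truth_rooted R C (nu p φ) V y).1 ⟨S, hS, hy⟩, rfl⟩
  · intro hn
    refine ⟨insert none (some '' truth R (nu p φ) fun q => some ⁻¹' V q), ?_,
      Set.mem_insert _ _⟩
    rintro _ (rfl | ⟨y, hy, rfl⟩)
    · exact hn
    · rw [some_mem_truth_rooted, preimage_update, preimage_some_insert_none]
      exact subset_truth_update_nu R h _ hy

/-- Truth at the root depends only on which of finitely many sets the set of successors of the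
root meets, and the number of these sets depends on the formula alone. -/
theorem exists_finite_none_mem_truth_iff (φ : MuFormula P) (h : φ.WellFormed) :
    ∃ (ι : Type) (_ : Finite ι), ∀ (W : Type u) (R : W → W → Prop) (V₀ : P → Set W),
      ∃ D : ι → Set W, ∀ C C' : Set W,
        (∀ i, (∃ x ∈ C, x ∈ D i) ↔ ∃ x ∈ C', x ∈ D i) →
        ∀ V : P → Set (Option W), (fun q => some ⁻¹' V q) = V₀ →
          (none ∈ truth (rooted R C) φ V ↔ none ∈ truth (rooted R C') φ V) := by
  induction φ with
  | var p => exact ⟨Empty, inferInstance, fun W R V₀ => ⟨Empty.elim, fun C C' _ V _ => Iff.rfl⟩⟩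
  | neg φ ih =>
    obtain ⟨ι, hι, H⟩ := ih h
    refine ⟨ι, hι, fun W R V₀ => ?_⟩
    obtain ⟨D, hD⟩ := H W R V₀
    exact ⟨D, fun C C' hC V hV => not_congr (hD C C' hC V hV)⟩
  | and φ ψ ih₁ ih₂ =>
    obtain ⟨ι₁, hι₁, H₁⟩ := ih₁ h.1
    obtain ⟨ι₂, hι₂, H₂⟩ := ih₂ h.2
    refine ⟨ι₁ ⊕ ι₂, inferInstance, fun W R V₀ => ?_⟩
    obtain ⟨D₁, hD₁⟩ := H₁ W R V₀
    obtain ⟨D₂, hD₂⟩ := H₂ W R V₀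
    exact ⟨Sum.elim D₁ D₂, fun C C' hC V hV =>
      and_congr (hD₁ C C' (fun i => hC (.inl i)) V hV) (hD₂ C C' (fun i => hC (.inr i)) V hV)⟩
  | dia φ ih =>
    refine ⟨Unit, inferInstance, fun W R V₀ => ⟨fun _ => truth R φ V₀, ?_⟩⟩
    rintro C C' hC V rfl
    have key : ∀ C : Set W, none ∈ truth (rooted R C) (dia φ) V ↔
        ∃ x ∈ C, x ∈ truth R φ fun q => some ⁻¹' V q := by
      intro C
      constructor
      · rintro ⟨_ | y, hR, hy⟩
        · exact hR.elim
        · exact ⟨y, hR, (some_mem_truth_rooted R C φ V y).1 hy⟩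
      · rintro ⟨y, hR, hy⟩
        exact ⟨some y, hR, (some_mem_truth_rooted R C φ V y).2 hy⟩
    rw [key, key]
    exact hC ()
  | mu p φ ih =>
    obtain ⟨ι, hι, H⟩ := ih h.2
    refine ⟨ι, hι, fun W R V₀ => ?_⟩
    -- The fixed point on the old frame does not depend on `C`, so it may be put into the valuation
    -- before `D` is chosen.
    obtain ⟨D, hD⟩ := H W R (update V₀ p (truth R (mu p φ) V₀))
    refine ⟨D, ?_⟩
    rintro C C' hC V rfl
    rw [none_mem_truth_mu R C h.1, none_mem_truth_mu R C' h.1]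
    exact hD C C' hC _ (by rw [preimage_update, preimage_some_image])
  | nu p φ ih =>
    obtain ⟨ι, hι, H⟩ := ih h.2
    refine ⟨ι, hι, fun W R V₀ => ?_⟩
    obtain ⟨D, hD⟩ := H W R (update V₀ p (truth R (nu p φ) V₀))
    refine ⟨D, ?_⟩
    rintro C C' hC V rfl
    rw [none_mem_truth_nu R C h.1, none_mem_truth_nu R C' h.1]
    exact hD C C' hC _ (by rw [preimage_update, preimage_some_insert_none])

end MuFormula

/-! ### The rank formula on rooted chains -/

namespace MISLFormula

open MuFormula (rooted)

variable {P : Type v} [DecidableEq P] {W : Type u}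

theorem mem_truth_box (R : W → W → Prop) (φ : MISLFormula P) (V : P → Set W) (s : W) :
    s ∈ truth R (box φ) V ↔ ∀ t, R s t → t ∈ truth R φ V := by
  simp [box, truth]

theorem mem_truth_or (R : W → W → Prop) (φ ψ : MISLFormula P) (V : P → Set W) (s : W) :
    s ∈ truth R (or φ ψ) V ↔ s ∈ truth R φ V ∨ s ∈ truth R ψ V := by
  simp [or, truth]
  tauto

/-- The states from which the player to move loses within `n` rounds of the game in which the
players move along `R` alternately and a player who cannot move loses. -/
def lossSet (R : W → W → Prop) : ℕ → Set W
  | 0 => {s | ∀ t, ¬ R s t}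
  | n + 1 => lossSet R n ∪ {s | ∀ t, R s t → ∃ r, R t r ∧ r ∈ lossSet R n}

theorem iterVal_eq_lossSet (R : W → W → Prop) (p : P) (V : P → Set W) (n : ℕ) :
    iterVal p (truth R (or (var p) (box (dia (var p)))))
      (update V p (truth R (box (bot p)) V)) n p = lossSet R n := by
  induction n with
  | zero =>
    ext s
    simp [iterVal, lossSet, mem_truth_box, bot, truth]
  | succ n ih =>
    ext s
    simp only [iterVal, update_self, mem_truth_or, mem_truth_box, lossSet]
    simp only [truth, ih, Set.mem_union, Set.mem_ofPred_eq]

/-- The second conjunct describes a successor lying in `lossSet R (n + 1)` but not in `lossSet R n`.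
-/
theorem mem_truth_rankFormula (R : W → W → Prop) (p : P) (V : P → Set W) (s : W) :
    s ∈ truth R (rankFormula p) V ↔ ∃ n, (∃ t, R s t ∧ t ∈ lossSet R n) ∧
      ∃ t, R s t ∧ t ∉ lossSet R n ∧ ∀ r, R t r → ∃ q, R r q ∧ q ∈ lossSet R n := by
  simp only [rankFormula]
  rw [truth, truth]
  simp only [Set.mem_ofPred_eq]
  refine exists_congr fun n => ?_
  have h := iterVal_eq_lossSet R p V n
  -- Only the value of the iterated valuation at `p` matters from here on.
  generalize iterVal p _ _ n = U at h ⊢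
  simp only [truth, h, Set.mem_inter_iff, Set.mem_ofPred_eq, Set.mem_compl_iff, mem_truth_box]

/-- The predecessor relation on `0, …, N - 1`. -/
def chain (N : ℕ) : ULift.{u} (Fin N) → ULift.{u} (Fin N) → Prop :=
  fun x y => x.down.val = y.down.val + 1

/-- Moves on the chain are forced: a move and its reply lower the position by two, and a player at
`0` is stuck. -/
theorem some_mem_lossSet_chain {N : ℕ} {C : Set (ULift.{u} (Fin N))} (n : ℕ) :
    ∀ x : ULift.{u} (Fin N),
      some x ∈ lossSet (rooted (chain N) C) n ↔ Even x.down.val ∧ x.down.val ≤ 2 * n := by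
  have hsucc : ∀ (x : ULift.{u} (Fin N)) (y : Option (ULift.{u} (Fin N))),
      rooted (chain N) C (some x) y ↔ ∃ z, y = some z ∧ x.down.val = z.down.val + 1 := by
    rintro x (_ | y)
    · simp [rooted]
    · simp [rooted, chain]
  induction n with
  | zero =>
    intro x
    simp only [lossSet, Set.mem_ofPred_eq, hsucc]
    constructor
    · intro h
      have : x.down.val = 0 := by
        by_contra h0
        exact h (some ⟨⟨x.down.val - 1, by omega⟩⟩) ⟨_, rfl, by simp only; omega⟩
      simp [this]
    · rintro ⟨-, h⟩ t ⟨z, -, hz⟩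
      omega
  | succ n ih =>
    intro x
    simp only [lossSet, Set.mem_union, Set.mem_ofPred_eq, hsucc, ih]
    constructor
    · rintro (⟨h, h'⟩ | h)
      · exact ⟨h, by omega⟩
      · rcases Nat.eq_zero_or_pos x.down.val with h0 | h0
        · simp [h0]
        · obtain ⟨r, hr, hl⟩ := h (some ⟨⟨x.down.val - 1, by omega⟩⟩)
            ⟨_, rfl, by simp only; omega⟩
          obtain ⟨_, hz, z, rfl, hz'⟩ : ∃ y : ULift.{u} (Fin N),
              x.down.val - 1 = y.down.val ∧ ∃ z, r = some z ∧ y.down.val = z.down.val + 1 := by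
            rw [hsucc] at hr
            obtain ⟨z, hz, h⟩ := hr
            exact ⟨⟨⟨x.down.val - 1, by omega⟩⟩, rfl, z, hz, h⟩
          rw [ih] at hl
          obtain ⟨⟨k, hk⟩, hle⟩ := hl
          exact ⟨⟨k + 1, by omega⟩, by omega⟩
    · rintro ⟨⟨k, hk⟩, hle⟩
      right
      rintro t ⟨z, rfl, hz⟩
      refine ⟨some ⟨⟨z.down.val - 1, by omega⟩⟩, ?_, ?_⟩
      · rw [hsucc]
        exact ⟨_, rfl, by simp only; omega⟩
      · rw [ih]
        exact ⟨⟨k - 1, by simp only; omega⟩, by simp only; omega⟩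

theorem none_mem_rankFormula_of_lt {N : ℕ} (p : P) (V : P → Set (Option (ULift.{u} (Fin N))))
    {x y : ULift.{u} (Fin N)} (hx : Even x.down.val) (hy : Even y.down.val)
    (h : x.down.val < y.down.val) :
    none ∈ truth (rooted (chain N) {x, y}) (rankFormula p) V := by
  rw [mem_truth_rankFormula]
  obtain ⟨a, ha⟩ := hx
  obtain ⟨b, hb⟩ := hy
  -- Since `y = 2b` enters at stage `b ≥ 1`, stage `b - 1` contains `x` but not yet `y`.
  have hloss : some y ∈ lossSet (rooted (chain N) {x, y}) (b - 1 + 1) :=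
    (some_mem_lossSet_chain _ y).2 ⟨⟨b, hb⟩, by omega⟩
  have hnot : some y ∉ lossSet (rooted (chain N) {x, y}) (b - 1) := fun hc => by
    have := ((some_mem_lossSet_chain _ y).1 hc).2
    omega
  refine ⟨b - 1, ⟨some x, Or.inl rfl, ?_⟩, some y, Or.inr rfl, hnot, hloss.resolve_left hnot⟩
  exact (some_mem_lossSet_chain _ x).2 ⟨⟨a, ha⟩, by omega⟩

/-- A lone successor cannot be both inside and outside the same stage. -/
theorem none_notMem_rankFormula_singleton (R : W → W → Prop) (p : P)
    (V : P → Set (Option W)) (x : W) :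
    none ∉ truth (rooted R {x}) (rankFormula p) V := by
  rw [mem_truth_rankFormula]
  rintro ⟨n, ⟨_ | t, ht, hl⟩, _ | r, hr, hn, -⟩
  · exact ht
  · exact ht
  · exact hr
  · obtain rfl : t = x := ht
    obtain rfl : r = t := hr
    exact hn hl

/-- Every formula of the modal `μ`-calculus disagrees with the rank formula on a finite model. -/
theorem exists_finite_not_sat_iff (p : P) (ψ : MuFormula P) (hψ : ψ.WellFormed) :
    ∃ (M : KripkeModel.{u} P) (_ : Finite M.W) (s : M.W),
      ¬ (Sat M s (rankFormula p) ↔ MuFormula.Sat M s ψ) := by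
  obtain ⟨ι, hι, H⟩ := MuFormula.exists_finite_none_mem_truth_iff.{u} ψ hψ
  -- The chain has one more even position than there are membership patterns in the sets `D i`, as
  -- the pigeonhole principle requires.
  let N := 2 * (Nat.card (ι → Prop) + 1)
  obtain ⟨D, hD⟩ := H (ULift.{u} (Fin N)) (chain N) fun _ => ∅
  let pt : Fin (Nat.card (ι → Prop) + 1) → ULift.{u} (Fin N) :=
    fun m => ⟨⟨2 * m.val, by have := m.isLt; omega⟩⟩
  obtain ⟨a, b, hab, heq⟩ : ∃ a b, a < b ∧ (fun i => pt a ∈ D i) = fun i => pt b ∈ D i := by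
    by_contra! hinj
    have : Injective fun (m : Fin (Nat.card (ι → Prop) + 1)) (i : ι) => pt m ∈ D i := by
      intro a b h
      by_contra hne
      rcases lt_or_gt_of_ne hne with hlt | hlt
      · exact hinj a b hlt h
      · exact hinj b a hlt h.symm
    have := Nat.card_le_card_of_injective _ this
    simp only [Nat.card_fin] at this
    omega
  let M : Set (ULift.{u} (Fin N)) → KripkeModel.{u} P := fun C =>
    ⟨Option (ULift.{u} (Fin N)), ⟨none⟩, rooted (chain N) C, fun _ => ∅⟩
  by_contra! hc
  have h₁ := hc (M {pt a, pt b}) (inferInstanceAs (Finite (Option _))) none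
  have h₂ := hc (M {pt a}) (inferInstanceAs (Finite (Option _))) none
  -- Adding `pt b` meets no new `D i`, as it has the same pattern as `pt a`.
  have h₃ := hD {pt a, pt b} {pt a} (fun i => by simpa using fun h => (congrFun heq i).mpr h)
    (fun _ => ∅) (by simp)
  exact none_notMem_rankFormula_singleton (chain N) p (fun _ => ∅) (pt a) (h₂.2 (h₃.1 (h₁.1
    (none_mem_rankFormula_of_lt p (fun _ => ∅) (even_two_mul _) (even_two_mul _)
      (Nat.mul_lt_mul_of_pos_left hab two_pos)))))

end MISLFormula

theorem mainTheorem9 {P : Type v} [Countable P] [DecidableEq P] (p : P) :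
    (¬ ∃ ψ : MuFormula P, ψ.WellFormed ∧
      ∀ (M : KripkeModel.{u} P) (s : M.W),
        MISLFormula.Sat M s (MISLFormula.rankFormula p) ↔ MuFormula.Sat M s ψ) ∧
    (¬ ∃ ψ : MuFormula P, ψ.WellFormed ∧
      ∀ (M : KripkeModel.{u} P) (s : M.W),
        MISLFormula.Sat M s (MISLFormula.rankFormula p) ↔ MuFormula.FinSat M s ψ) := by
  constructor
  · rintro ⟨ψ, hψ, h⟩
    obtain ⟨M, -, s, hM⟩ := MISLFormula.exists_finite_not_sat_iff p ψ hψ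
    exact hM (h M s)
  · rintro ⟨ψ, hψ, h⟩
    obtain ⟨M, hfin, s, hM⟩ := MISLFormula.exists_finite_not_sat_iff p ψ hψ
    refine hM ((h M s).trans ?_)
    rw [MuFormula.FinSat, MuFormula.Sat, MuFormula.finTruth_eq_truth M.R ψ hψ]
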